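/- **Setting.** Let $\mathcal Z\subseteq\mathbb R^{d_X}\times\mathbb R^{d_Y}$ be the set of examples $z=(x,y)$. Let $h_\theta$, $\theta\in\mathbb R^d$, be hypotheses and $\ell$ a loss such that $\theta\mapsto\ell(h_\theta(x),y)$ is differentiable for every $(x,y)\in\mathcal Z$. For $S=(z_1,\dots,z_N)\in\mathcal Z^N$ with $N\ge 1$, put $\hat{\mathcal R}_S(\theta)=\frac1N\sum_{i=1}^N\ell(h_\theta(x_i),y_i)$. Let $\|\cdot\|$ be any norm on $\mathbb R^d$ and $b>0$. Write $\mathrm{Lap}(m,b)$ for the probability distribution on $\mathbb R^d$ with density proportional to $g\mapsto e^{-\|g-m\|/b}$. $T$-iteration SGD for ERM on $S$ draws $\theta_1$ from an initial law that does not depend on $S$ (for instance a fixed point). For $t=1,\dots,T$ it sets $\theta_{t+1}=\theta_t-\eta_t\hat g_t$ with learning rates $\eta_t$. The mini-batch gradient noise is modelled as Laplacian: given the past, $\hat g_t\sim\mathrm{Lap}(\nabla_\theta\hat{\mathcal R}_S(\theta_t),b)$. The output is $\theta_{T+1}$. Let $L^{\mathrm{ERM}}_t$ be the largest value that $\sup_{(x,y)\in\mathcal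 Z}\|\nabla_\theta\ell(h_\theta(x),y)|_{\theta=\theta_t}\|$ can take up to probability zero, that is, the supremum over $S\in\mathcal Z^N$ of its essential supremum over the law of $\theta_t$. Suppose that $L^{\mathrm{ERM}}_t\le M<\infty$ for $t=1,\dots,T$, and put $L^{\mathrm{ERM}}_{1:T}=\big(\frac1T\sum_{t=1}^T(L^{\mathrm{ERM}}_t)^4\big)^{1/4}$ and $\varepsilon^{\mathrm{ERM}}_{1:T}=\frac{2L^{\mathrm{ERM}}_{1:T}}{Nb}$. A stochastic algorithm $\mathcal A$ is $(\varepsilon,\delta)$-differentially private if $\mathbb P(\mathcal A(S)\in B)\le e^{\varepsilon}\,\mathbb P(\mathcal A(S')\in B)+\delta$ for all measurable $B$ and all $S,S'\in\mathcal Z^N$ that differ in only one example. **Statement.** There is a constant $C$, depending only on $T$, $b$ and $M$, such that for every $N\ge1$ and every $\delta'>0$ the SGD above is $(\varepsilon,\delta)$-differentially private with $$\varepsilon=\varepsilon^{\mathrm{ERM}}_{1:T}\sqrt{2T\log\frac N{\delta'}}+\frac{C}{N^2},\qquad \delta=\frac{\delta'}N ,$$ where the square root is read as $0$ if $\delta'>N$.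 This holds both when the algorithm releases only its output $\theta_{T+1}$ and when it releases the whole trajectory $(\theta_1,\dots,\theta_{T+1})$. -/

import Mathlib

open MeasureTheory

noncomputable section

namespace PrivateERM

/-- The space of weight vectors. -/
abbrev Weight (d : ℕ) : Type := EuclideanSpace ℝ (Fin d)

/-- The space in which the examples `z = (x, y)` live. -/
abbrev Example (dX dY : ℕ) : Type := EuclideanSpace ℝ (Fin dX) × EuclideanSpace ℝ (Fin dY)

/-- `S` and `S'` differ in (at most) one example. -/
def Neighbouring {N : ℕ} {X : Type*} (S S' : Fin N → X) : Prop :=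
  ∃ i, ∀ j, j ≠ i → S j = S' j

/-- Differential privacy of a stochastic algorithm, given by the law `A S` of its output on
each sample set `S`: `ℙ(A(S) ∈ B) ≤ e ^ ε * ℙ(A(S') ∈ B) + δ`, that is,
`log ((ℙ(A(S) ∈ B) - δ) / ℙ(A(S') ∈ B)) ≤ ε`, for all neighbouring `S`, `S'` and all events `B`. -/
def IsDifferentiallyPrivate {N : ℕ} {X H : Type*} [MeasurableSpace H]
    (A : (Fin N → X) → Measure H) (ε δ : ℝ) : Prop :=
  ∀ S S' : Fin N → X, Neighbouring S S' → ∀ B : Set H, MeasurableSet B →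
    A S B ≤ ENNReal.ofReal (Real.exp ε) * A S' B + ENNReal.ofReal δ

/-- The loss `ℓ(h_θ(x), y)` of the hypothesis `h_θ` on the example `(x, y)`. -/
def exampleLoss {d dX dY : ℕ} {P : Type*} (h : Weight d → EuclideanSpace ℝ (Fin dX) → P)
    (l : P → EuclideanSpace ℝ (Fin dY) → ℝ) (θ : Weight d) (z : Example dX dY) : ℝ :=
  l (h θ z.1) z.2

section SGD

variable {d dX dY N : ℕ} {Z : Set (Example dX dY)}

/-- The empirical risk of the weight `θ` on the sample set `S`. -/
def empiricalRisk (f : Weight d → Example dX dY → ℝ) (S : Fin N → Z) (θ : Weight d) : ℝ :=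
  (1 / (N : ℝ)) * ∑ i, f θ (S i)

/-- The Laplacian distribution with centre `m` and scale `b` for the norm `nrm` on the weight
space: its Lebesgue density is proportional to `exp (-nrm (g - m) / b)`. -/
def laplace (nrm : Seminorm ℝ (Weight d)) (b : ℝ) (m : Weight d) : Measure (Weight d) :=
  (∫⁻ x : Weight d, ENNReal.ofReal (Real.exp (-nrm x / b)))⁻¹ •
    (volume : Measure (Weight d)).withDensity
      (fun g => ENNReal.ofReal (Real.exp (-nrm (g - m) / b)))

/-- Law of the weight `θ - η ĝ` after one iteration started at `θ`, where the stochastic gradient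
`ĝ` is drawn from the Laplacian distribution centred at the gradient of the empirical risk. -/
def sgdStep (f : Weight d → Example dX dY → ℝ) (nrm : Seminorm ℝ (Weight d)) (b : ℝ)
    (S : Fin N → Z) (η : ℝ) (θ : Weight d) : Measure (Weight d) :=
  (laplace nrm b (gradient (empiricalRisk f S) θ)).map (fun g => θ - η • g)

/-- Law of the weights `(θ₁, …, θ_{T+1})` produced by `T` iterations of SGD on the sample set `S`,
with initial law `μ₀` and learning rates `η 0, η 1, …`; coordinate `t` holds the weight before
the iteration number `t` (counted from `0`), and the last coordinate is the final weight. -/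
def sgdTrajectory (f : Weight d → Example dX dY → ℝ) (nrm : Seminorm ℝ (Weight d)) (b : ℝ)
    (μ₀ : Measure (Weight d)) (η : ℕ → ℝ) (S : Fin N → Z) :
    (T : ℕ) → Measure (Fin (T + 1) → Weight d)
  | 0 => μ₀.map (fun θ _ => θ)
  | T + 1 => (sgdTrajectory f nrm b μ₀ η S T).bind fun w =>
      (sgdStep f nrm b S (η T) (w (Fin.last T))).map
        (fun θ => (Fin.snoc w θ : Fin (T + 2) → Weight d))

/-- Law of the final weight, the output of `T` iterations of SGD. -/
def sgdOutput (f : Weight d → Example dX dY → ℝ) (nrm : Seminorm ℝ (Weight d)) (b : ℝ)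
    (μ₀ : Measure (Weight d)) (η : ℕ → ℝ) (T : ℕ) (S : Fin N → Z) : Measure (Weight d) :=
  (sgdTrajectory f nrm b μ₀ η S T).map (fun w => w (Fin.last T))

end SGD

/-- The number `L_t`: the largest value that `sup_{z ∈ Z} ‖∇_θ f(θ, z)‖`, taken at the (random)
weight `θ = θ_t` of the iteration `t`, can attain (up to probability zero) when SGD is run on a
sample set of size `N` from `Z`. -/
def gradientBound {d dX dY : ℕ} (Z : Set (Example dX dY)) (f : Weight d → Example dX dY → ℝ)
    (nrm : Seminorm ℝ (Weight d)) (b : ℝ) (μ₀ : Measure (Weight d)) (η : ℕ → ℝ) (N T : ℕ)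
    (t : Fin T) : ENNReal :=
  ⨆ S : Fin N → Z, essSup
    (fun w : Fin (T + 1) → Weight d =>
      ⨆ z ∈ Z, ENNReal.ofReal (nrm (gradient (fun θ => f θ z) (w t.castSucc))))
    (sgdTrajectory f nrm b μ₀ η S T)

/-- The fourth-power mean `((1 / T) * ∑ L_t ^ 4) ^ (1 / 4)`. -/
def fourthMean {T : ℕ} (L : Fin T → ℝ) : ℝ :=
  ((1 / (T : ℝ)) * ∑ t, L t ^ 4) ^ (1 / 4 : ℝ)

section WellDefined

variable {d dX dY N : ℕ} {Z : Set (Example dX dY)}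

theorem seminorm_continuous (nrm : Seminorm ℝ (Weight d)) : Continuous nrm :=
  continuousOn_univ.1 (nrm.convexOn.continuousOn isOpen_univ)

theorem exists_le_seminorm (nrm : Seminorm ℝ (Weight d)) (hn : ∀ v, nrm v = 0 → v = 0) :
    ∃ c : ℝ, 0 < c ∧ ∀ v, c * ‖v‖ ≤ nrm v := by
  have hc := seminorm_continuous nrm
  rcases (Metric.sphere (0 : Weight d) 1).eq_empty_or_nonempty with he | hne
  · refine ⟨1, one_pos, fun v => ?_⟩
    have : v = 0 := by
      by_contra hv
      have : ‖v‖⁻¹ • v ∈ Metric.sphere (0 : Weight d) 1 := by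
        simp [norm_smul, hv]
      simp [he] at this
    simp [this]
  · obtain ⟨x, hx, hmin⟩ := (isCompact_sphere (0 : Weight d) 1).exists_isMinOn hne hc.continuousOn
    have hx1 : ‖x‖ = 1 := by simpa using hx
    have hx0 : x ≠ 0 := by rintro rfl; simp at hx1
    refine ⟨nrm x, lt_of_le_of_ne (apply_nonneg _ _) (fun h => hx0 (hn x h.symm)), fun v => ?_⟩
    by_cases hv : v = 0
    · simp [hv]
    · have hm : ‖v‖⁻¹ • v ∈ Metric.sphere (0 : Weight d) 1 := by
        simp [norm_smul, hv]
      have h1 : nrm x ≤ nrm (‖v‖⁻¹ • v) := hmin hm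
      rw [map_smul_eq_mul, norm_inv, norm_norm] at h1
      have h2 : 0 < ‖v‖ := norm_pos_iff.2 hv
      calc nrm x * ‖v‖ ≤ (‖v‖⁻¹ * nrm v) * ‖v‖ := by gcongr
        _ = nrm v := by field_simp

theorem integral_ne_top (nrm : Seminorm ℝ (Weight d)) (hn : ∀ v, nrm v = 0 → v = 0)
    {b : ℝ} (hb : 0 < b) :
    ∫⁻ x : Weight d, ENNReal.ofReal (Real.exp (-nrm x / b)) ≠ ⊤ := by
  obtain ⟨c, hc, hle⟩ := exists_le_seminorm nrm hn
  have hi : Integrable (fun x : Weight d => Real.exp (-(c / b) * ‖x‖)) := by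
    rcases Nat.eq_zero_or_pos d with rfl | hd
    · exact Integrable.of_finite
    have : Nontrivial (Weight d) := by
      have : Nonempty (Fin d) := ⟨⟨0, hd⟩⟩
      infer_instance
    rw [integrable_fun_norm_addHaar (volume : Measure (Weight d)) (f := fun r => Real.exp (-(c/b) * r))]
    have := integrableOn_rpow_mul_exp_neg_mul_rpow (s := (Module.finrank ℝ (Weight d) - 1 : ℕ)) (p := 1) (b := c / b) (by
      have : (0:ℝ) ≤ ((Module.finrank ℝ (Weight d) - 1 : ℕ):ℝ) := by positivity
      linarith) one_pos (by positivity)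
    simpa [smul_eq_mul] using this
  refine (lt_of_le_of_lt (lintegral_mono fun x => ?_) hi.lintegral_lt_top).ne
  apply ENNReal.ofReal_le_ofReal
  apply Real.exp_le_exp.2
  rw [div_le_iff₀ hb]
  have := hle x
  have e : -(c / b) * ‖x‖ * b = -(c * ‖x‖) := by field_simp
  linarith

theorem integral_ne_zero (nrm : Seminorm ℝ (Weight d)) (b : ℝ) :
    ∫⁻ x : Weight d, ENNReal.ofReal (Real.exp (-nrm x / b)) ≠ 0 := by
  have hm : Measurable fun x : Weight d => ENNReal.ofReal (Real.exp (-nrm x / b)) :=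
    (ENNReal.continuous_ofReal.comp
      (Real.continuous_exp.comp ((seminorm_continuous nrm).neg.div_const b))).measurable
  rw [Ne, lintegral_eq_zero_iff hm]
  intro h
  have : ∀ᵐ x : Weight d, False := by
    filter_upwards [h] with x hx
    simp at hx
    linarith [Real.exp_pos (-nrm x / b)]
  simp [NeZero.ne] at this

theorem isProbabilityMeasure_laplace (nrm : Seminorm ℝ (Weight d)) (hn : ∀ v, nrm v = 0 → v = 0)
    {b : ℝ} (hb : 0 < b) (m : Weight d) : IsProbabilityMeasure (laplace nrm b m) := by
  constructor
  simp only [laplace, Measure.smul_apply, smul_eq_mul, withDensity_apply _ MeasurableSet.univ,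
    Measure.restrict_univ]
  rw [lintegral_sub_right_eq_self (fun g : Weight d => ENNReal.ofReal (Real.exp (-nrm g / b))) m]
  exact ENNReal.inv_mul_cancel (integral_ne_zero nrm b) (integral_ne_top nrm hn hb)

theorem measurable_gradient (R : Weight d → ℝ) : Measurable (gradient R) := by
  unfold gradient
  exact (InnerProductSpace.toDual ℝ (Weight d)).symm.continuous.measurable.comp (measurable_fderiv ℝ R)

theorem measurable_laplace (nrm : Seminorm ℝ (Weight d)) (b : ℝ) :
    Measurable (laplace nrm b) := by
  refine Measure.measurable_of_measurable_coe _ fun B hB => ?_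
  simp only [laplace, Measure.smul_apply, smul_eq_mul, withDensity_apply _ hB]
  refine Measurable.const_mul ?_ _
  refine Measurable.lintegral_prod_right' (ν := volume.restrict B)
    (f := fun q : Weight d × Weight d => ENNReal.ofReal (Real.exp (-nrm (q.2 - q.1) / b))) ?_
  exact (ENNReal.continuous_ofReal.comp (Real.continuous_exp.comp
    (((seminorm_continuous nrm).comp (continuous_snd.sub continuous_fst)).neg.div_const b))).measurable

theorem measurable_snoc (T : ℕ) : Measurable (fun q : (Fin (T+1) → Weight d) × Weight d =>
    (Fin.snoc q.1 q.2 : Fin (T + 2) → Weight d)) := by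
  refine measurable_pi_lambda _ fun i => ?_
  refine Fin.lastCases ?_ (fun j => ?_) i
  · simpa using measurable_snd
  · simpa [Function.comp_def] using (measurable_pi_apply j).comp measurable_fst

theorem measurable_step (f : Weight d → Example dX dY → ℝ) (nrm : Seminorm ℝ (Weight d))
    (hn : ∀ v, nrm v = 0 → v = 0) {b : ℝ} (hb : 0 < b) (S : Fin N → Z) (η : ℝ) (T : ℕ) :
    Measurable (fun w : Fin (T+1) → Weight d => (sgdStep f nrm b S η (w (Fin.last T))).map
        (fun θ => (Fin.snoc w θ : Fin (T + 2) → Weight d))) := by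
  let κ : ProbabilityTheory.Kernel (Fin (T+1) → Weight d) (Weight d) :=
    ⟨fun w => laplace nrm b (gradient (empiricalRisk f S) (w (Fin.last T))),
      (measurable_laplace nrm b).comp ((measurable_gradient _).comp (measurable_pi_apply _))⟩
  have : ProbabilityTheory.IsMarkovKernel κ := ⟨fun w => isProbabilityMeasure_laplace nrm hn hb _⟩
  have hF : Measurable (fun q : (Fin (T+1) → Weight d) × Weight d =>
      (Fin.snoc q.1 (q.1 (Fin.last T) - η • q.2) : Fin (T + 2) → Weight d)) :=
    (measurable_snoc T).comp (measurable_fst.prodMk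
      (((measurable_pi_apply (Fin.last T)).comp measurable_fst).sub (measurable_snd.const_smul η)))
  have hs (w : Fin (T+1) → Weight d) :
      Measurable (fun θ => (Fin.snoc w θ : Fin (T + 2) → Weight d)) :=
    (measurable_snoc T).comp (measurable_const.prodMk measurable_id)
  convert (((ProbabilityTheory.Kernel.id.prod κ).map (fun q : (Fin (T+1) → Weight d) × Weight d =>
      (Fin.snoc q.1 (q.1 (Fin.last T) - η • q.2) : Fin (T + 2) → Weight d)))).measurable using 2 with w
  rw [ProbabilityTheory.Kernel.map_apply _ hF, ProbabilityTheory.Kernel.prod_apply,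
    ProbabilityTheory.Kernel.id_apply, Measure.dirac_prod,
    Measure.map_map hF (by fun_prop), sgdStep, Measure.map_map
      (hs w) (by fun_prop)]
  rfl

/-- The law of the trajectory is well defined: it is a probability measure. -/
theorem isProbabilityMeasure_sgdTrajectory (f : Weight d → Example dX dY → ℝ) (nrm : Seminorm ℝ (Weight d))
    (hn : ∀ v, nrm v = 0 → v = 0) {b : ℝ} (hb : 0 < b) (μ₀ : Measure (Weight d))
    [IsProbabilityMeasure μ₀] (η : ℕ → ℝ) (S : Fin N → Z) (T : ℕ) :
    IsProbabilityMeasure (sgdTrajectory f nrm b μ₀ η S T) := by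
  induction T with
  | zero => exact Measure.isProbabilityMeasure_map (by fun_prop)
  | succ T ih =>
    rw [sgdTrajectory]
    refine isProbabilityMeasure_bind (measurable_step f nrm hn hb S (η T) T).aemeasurable ?_
    refine Filter.Eventually.of_forall fun w => ?_
    have := isProbabilityMeasure_laplace nrm hn hb (gradient (empiricalRisk f S) (w (Fin.last T)))
    have : IsProbabilityMeasure (sgdStep f nrm b S (η T) (w (Fin.last T))) :=
      Measure.isProbabilityMeasure_map (by fun_prop)
    exact Measure.isProbabilityMeasure_map
      ((measurable_snoc T).comp (measurable_const.prodMk measurable_id)).aemeasurable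

end WellDefined

end PrivateERM

end

noncomputable section

namespace PrivateERM

open ProbabilityTheory

/-! ### Bounded privacy losses: mean, exponential moment, tail -/

section PrivacyLoss

/-! The privacy loss of a trajectory, i.e. the log-density of its law under `S` relative to `S'`, is
a sum of one loss per iteration. Given the past, the two Laplacians differ only in their centres, so
the triangle inequality bounds the loss of iteration `t` by `ε t = 2 * L t / (N * b)`, almost surely
under `S`: replacing one example moves the mean gradient by at most `2 * L t / N`.

A loss bounded by `ε` has mean at most `ε ^ 2 * exp ε`, because `exp (-X)` integrates to one, and
Hoeffding's lemma controls its fluctuation (`lintegral_exp_mul_le`). Conditioning on the past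
multiplies these bounds (`lintegral_exp_trajectoryLoss_le`). A Chernoff argument then gives privacy
(`measure_le_of_lintegral_exp_mul_le`, `exists_chernoff_exponent`): the fluctuations produce the
square root term, through `∑ t, ε t ^ 2` and Cauchy–Schwarz, while the means sum to `O(1 / N ^ 2)`
and go into `C`. The output is a function of the trajectory, so it inherits the guarantee. -/

theorem exp_le_one_add_add_sq_mul_exp (x : ℝ) :
    Real.exp x ≤ 1 + x + x ^ 2 * Real.exp |x| := by
  have h := Complex.norm_exp_sub_sum_le_norm_mul_exp (x : ℂ) 2
  have e : Complex.exp (x : ℂ) - ∑ m ∈ Finset.range 2, (x : ℂ) ^ m / (m.factorial : ℂ)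
      = ((Real.exp x - (1 + x) : ℝ) : ℂ) := by
    simp [Finset.sum_range_succ]
  rw [e, Complex.norm_real, Complex.norm_real, Real.norm_eq_abs, Real.norm_eq_abs, sq_abs] at h
  linarith [le_abs_self (Real.exp x - (1 + x))]

/-- A bounded privacy loss `X` has mean at most quadratic in its bound. -/
theorem integral_le_of_integral_exp_neg_eq_one {Ω : Type*} [MeasurableSpace Ω] {ν : Measure Ω}
    [IsProbabilityMeasure ν] {X : Ω → ℝ} (hX : Measurable X) {ε : ℝ} (hε : ∀ ω, |X ω| ≤ ε)
    (h1 : ∫ ω, Real.exp (-X ω) ∂ν = 1) :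
    ∫ ω, X ω ∂ν ≤ ε ^ 2 * Real.exp ε := by
  have hi : Integrable X ν := Integrable.of_bound hX.aestronglyMeasurable ε
    (Filter.Eventually.of_forall hε)
  have hie : Integrable (fun ω => Real.exp (-X ω)) ν :=
    Integrable.of_bound (by fun_prop) (Real.exp ε) (Filter.Eventually.of_forall fun ω => by
      rw [Real.norm_eq_abs, Real.abs_exp]
      exact Real.exp_le_exp.2 ((neg_le_abs _).trans (hε ω)))
  -- The left side is 1, so the constants cancel and only the quadratic remainder bounds the mean.
  have h2 : ∫ ω, Real.exp (-X ω) ∂ν ≤ ∫ ω, (1 + ε ^ 2 * Real.exp ε - X ω) ∂ν := by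
    refine integral_mono hie ((integrable_const _).sub hi) fun ω => ?_
    have := exp_le_one_add_add_sq_mul_exp (-X ω)
    have h3 : (-X ω) ^ 2 * Real.exp |-X ω| ≤ ε ^ 2 * Real.exp ε := by
      rw [abs_neg, neg_sq, ← sq_abs]
      gcongr <;> exact hε ω
    simp only
    linarith
  rw [h1, integral_sub (integrable_const _) hi, integral_const] at h2
  simp at h2
  linarith

/-- Split `X` into its mean and the centred part. The mean is quadratic in `ε`; Hoeffding's lemma on
`[-ε, ε]` makes the centred part sub-Gaussian with variance proxy `ε ^ 2`. -/
theorem lintegral_exp_mul_le {Ω : Type*} [MeasurableSpace Ω] {ν : Measure Ω}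
    [IsProbabilityMeasure ν] {X : Ω → ℝ} (hX : Measurable X) {ε : ℝ} (hε : ∀ ω, |X ω| ≤ ε)
    (h1 : ∫⁻ ω, ENNReal.ofReal (Real.exp (-X ω)) ∂ν = 1) {c : ℝ} (hc : 0 ≤ c) :
    ∫⁻ ω, ENNReal.ofReal (Real.exp (c * X ω)) ∂ν
      ≤ ENNReal.ofReal (Real.exp (c * (ε ^ 2 * Real.exp ε) + c ^ 2 * ε ^ 2 / 2)) := by
  have h1' : ∫ ω, Real.exp (-X ω) ∂ν = 1 := by
    rw [integral_eq_lintegral_of_nonneg_ae (Filter.Eventually.of_forall fun _ => (Real.exp_pos _).le)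
      (by fun_prop), h1, ENNReal.toReal_one]
  have hm := integral_le_of_integral_exp_neg_eq_one hX hε h1'
  have hs := hasSubgaussianMGF_of_mem_Icc (μ := ν) (a := -ε) (b := ε) hX.aemeasurable
    (Filter.Eventually.of_forall fun ω => abs_le.1 (hε ω))
  have hv : (((‖ε - -ε‖₊ / 2) ^ 2 : NNReal) : ℝ) = ε ^ 2 := by
    simp [← two_mul]
  have hs1 := hs.mgf_le c
  rw [hv, mgf] at hs1
  have hi := hs.integrable_exp_mul c
  have e (ω : Ω) : Real.exp (c * X ω)
      = Real.exp (c * ∫ ω, X ω ∂ν) * Real.exp (c * (X ω - ∫ ω, X ω ∂ν)) := by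
    rw [← Real.exp_add]; congr 1; ring
  rw [← ofReal_integral_eq_lintegral_ofReal (by simp_rw [e]; exact hi.const_mul _)
    (Filter.Eventually.of_forall fun _ => (Real.exp_pos _).le)]
  apply ENNReal.ofReal_le_ofReal
  simp_rw [e]
  rw [integral_const_mul, Real.exp_add]
  refine mul_le_mul (Real.exp_le_exp.2 (mul_le_mul_of_nonneg_left hm hc)) (hs1.trans ?_)
    (integral_nonneg fun _ => (Real.exp_pos _).le) (Real.exp_pos _).le
  apply le_of_eq; congr 1; ring

/-- A bound on the exponential moment of the privacy loss `X` gives a bound between the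
probabilities under the two laws. -/
theorem measure_le_of_lintegral_exp_mul_le {Ω : Type*} [MeasurableSpace Ω] {μ μ' : Measure Ω}
    {X : Ω → ℝ} (hX : Measurable X)
    (hμ : ∀ f : Ω → ENNReal, Measurable f →
      ∫⁻ ω, f ω ∂μ' = ∫⁻ ω, f ω * ENNReal.ofReal (Real.exp (-X ω)) ∂μ)
    {c K ε δ : ℝ} (hc : 0 ≤ c)
    (hmom : ∫⁻ ω, ENNReal.ofReal (Real.exp (c * X ω)) ∂μ ≤ ENNReal.ofReal (Real.exp K))
    (hδ : Real.exp (K - c * ε) ≤ δ) {B : Set Ω} (hB : MeasurableSet B) :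
    μ B ≤ ENNReal.ofReal (Real.exp ε) * μ' B + ENNReal.ofReal δ := by
  have h1 : μ' B = ∫⁻ ω, B.indicator 1 ω * ENNReal.ofReal (Real.exp (-X ω)) ∂μ := by
    rw [← hμ _ (measurable_one.indicator hB), lintegral_indicator_one hB]
  have hme (r : ℝ) : Measurable fun ω => ENNReal.ofReal (Real.exp (r * X ω)) := by fun_prop
  have hmn : Measurable fun ω => ENNReal.ofReal (Real.exp (-X ω)) := by fun_prop
  have h2 : ENNReal.ofReal δ ≥ ∫⁻ ω, ENNReal.ofReal (Real.exp (-(c * ε))) *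
      ENNReal.ofReal (Real.exp (c * X ω)) ∂μ := by
    rw [lintegral_const_mul _ (hme c)]
    calc _ ≤ ENNReal.ofReal (Real.exp (-(c * ε))) * ENNReal.ofReal (Real.exp K) := by gcongr
      _ = ENNReal.ofReal (Real.exp (K - c * ε)) := by
        rw [← ENNReal.ofReal_mul (Real.exp_pos _).le, ← Real.exp_add]; ring_nf
      _ ≤ _ := ENNReal.ofReal_le_ofReal hδ
  refine le_trans ?_ (add_le_add_right h2 _)
  rw [h1, ← lintegral_const_mul _ (show Measurable fun ω => B.indicator 1 ω *
      ENNReal.ofReal (Real.exp (-X ω)) from (measurable_one.indicator hB).mul hmn),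
    ← lintegral_add_right _ ((hme c).const_mul _), ← lintegral_indicator_one hB]
  refine lintegral_mono fun ω => ?_
  -- On `B` the pointwise inequality is `1 ≤ exp (ε - X) + exp (c * (X - ε))`: the first term
  -- suffices when `X ≤ ε`, the second when `X ≥ ε`.
  by_cases hω : ω ∈ B
  · simp only [Set.indicator_of_mem hω, Pi.one_apply, one_mul]
    rw [← ENNReal.ofReal_mul (Real.exp_pos _).le, ← ENNReal.ofReal_mul (Real.exp_pos _).le,
      ← Real.exp_add, ← Real.exp_add]
    rcases le_total (X ω) ε with h | h
    · refine le_add_right ?_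
      rw [ENNReal.one_le_ofReal]
      exact Real.one_le_exp (by linarith)
    · refine le_add_left ?_
      rw [ENNReal.one_le_ofReal]
      exact Real.one_le_exp (by linarith [mul_le_mul_of_nonneg_left h hc])
  · simp [Set.indicator_of_notMem hω]

end PrivacyLoss

/-! ### Privacy loss of one Laplacian draw -/

section Laplace

variable {d : ℕ}

/-- The logarithm at `g` of the density of the Laplacian centred at `m` with respect to the one
centred at `m'`. -/
def laplaceLoss (nrm : Seminorm ℝ (Weight d)) (b : ℝ) (m m' g : Weight d) : ℝ :=
  (nrm (g - m') - nrm (g - m)) / b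

theorem measurable_laplaceLoss {α : Type*} [MeasurableSpace α] (nrm : Seminorm ℝ (Weight d)) (b : ℝ)
    {m m' g : α → Weight d} (hm : Measurable m) (hm' : Measurable m') (hg : Measurable g) :
    Measurable fun x => laplaceLoss nrm b (m x) (m' x) (g x) :=
  have h := (seminorm_continuous nrm).measurable
  ((h.comp (hg.sub hm')).sub (h.comp (hg.sub hm))).div_const b

theorem abs_laplaceLoss_le (nrm : Seminorm ℝ (Weight d)) {b : ℝ} (hb : 0 < b)
    (m m' g : Weight d) : |laplaceLoss nrm b m m' g| ≤ nrm (m - m') / b := by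
  rw [laplaceLoss, abs_div, abs_of_pos hb]
  gcongr
  have h := abs_sub_map_le_sub nrm (g - m') (g - m)
  rwa [sub_sub_sub_cancel_left] at h

/-- The normalising constant does not depend on the centre, so the density ratio is a pure
exponential. -/
theorem lintegral_laplace (nrm : Seminorm ℝ (Weight d)) {b : ℝ} (m m' : Weight d)
    (f : Weight d → ENNReal) :
    ∫⁻ g, f g ∂laplace nrm b m'
      = ∫⁻ g, f g * ENNReal.ofReal (Real.exp (-laplaceLoss nrm b m m' g)) ∂laplace nrm b m := by
  have hc := seminorm_continuous nrm
  have hm (m : Weight d) :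
      Measurable fun g : Weight d => ENNReal.ofReal (Real.exp (-nrm (g - m) / b)) :=
    (ENNReal.continuous_ofReal.comp (by fun_prop :
      Continuous fun g : Weight d => Real.exp (-nrm (g - m) / b))).measurable
  simp only [laplace, lintegral_smul_measure]
  congr 1
  rw [lintegral_withDensity_eq_lintegral_mul_non_measurable _ (hm m')
      (Filter.Eventually.of_forall fun _ => ENNReal.ofReal_lt_top),
    lintegral_withDensity_eq_lintegral_mul_non_measurable _ (hm m)
      (Filter.Eventually.of_forall fun _ => ENNReal.ofReal_lt_top)]
  refine lintegral_congr fun g => ?_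
  simp only [Pi.mul_apply]
  rw [mul_comm (f g), ← mul_assoc, ← ENNReal.ofReal_mul (Real.exp_pos _).le, ← Real.exp_add]
  congr 4
  rw [laplaceLoss]; ring

theorem lintegral_laplace_exp_mul_le (nrm : Seminorm ℝ (Weight d)) (hn : ∀ v, nrm v = 0 → v = 0)
    {b : ℝ} (hb : 0 < b) {m m' : Weight d} {ε : ℝ} (hε : nrm (m - m') / b ≤ ε) {c : ℝ}
    (hc : 0 ≤ c) :
    ∫⁻ g, ENNReal.ofReal (Real.exp (c * laplaceLoss nrm b m m' g)) ∂laplace nrm b m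
      ≤ ENNReal.ofReal (Real.exp (c * (ε ^ 2 * Real.exp ε) + c ^ 2 * ε ^ 2 / 2)) := by
  have := isProbabilityMeasure_laplace nrm hn hb m
  have := isProbabilityMeasure_laplace nrm hn hb m'
  refine lintegral_exp_mul_le ?_ (fun g => (abs_laplaceLoss_le nrm hb m m' g).trans hε) ?_ hc
  · exact measurable_laplaceLoss nrm b measurable_const measurable_const measurable_id
  · simpa using (lintegral_laplace nrm (b := b) m m' 1).symm

end Laplace

/-! ### Privacy loss along the trajectory and adaptive composition -/

section Trajectory

variable {d dX dY N : ℕ} {Z : Set (Example dX dY)}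

theorem lintegral_sgdTrajectory_succ (f : Weight d → Example dX dY → ℝ)
    (nrm : Seminorm ℝ (Weight d)) (hn : ∀ v, nrm v = 0 → v = 0) {b : ℝ} (hb : 0 < b)
    (μ₀ : Measure (Weight d)) (η : ℕ → ℝ) (S : Fin N → Z) (T : ℕ)
    {F : (Fin (T + 2) → Weight d) → ENNReal} (hF : Measurable F) :
    ∫⁻ w, F w ∂sgdTrajectory f nrm b μ₀ η S (T + 1)
      = ∫⁻ w, ∫⁻ g, F (Fin.snoc w (w (Fin.last T) - η T • g))
          ∂laplace nrm b (gradient (empiricalRisk f S) (w (Fin.last T)))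
          ∂sgdTrajectory f nrm b μ₀ η S T := by
  rw [sgdTrajectory, Measure.lintegral_bind (measurable_step f nrm hn hb S (η T) T).aemeasurable
    hF.aemeasurable]
  refine lintegral_congr fun w => ?_
  have hs : Measurable (fun θ => (Fin.snoc w θ : Fin (T + 2) → Weight d)) :=
    (measurable_snoc T).comp (measurable_const.prodMk measurable_id)
  rw [lintegral_map hF hs, sgdStep,
    lintegral_map (f := fun θ => F (Fin.snoc w θ)) (hF.comp hs) (by fun_prop)]

/-- Each step is a probability law given the past, so it integrates out to 1. -/
theorem map_init_sgdTrajectory (f : Weight d → Example dX dY → ℝ)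
    (nrm : Seminorm ℝ (Weight d)) (hn : ∀ v, nrm v = 0 → v = 0) {b : ℝ} (hb : 0 < b)
    (μ₀ : Measure (Weight d)) (η : ℕ → ℝ) (S : Fin N → Z) (T : ℕ) :
    (sgdTrajectory f nrm b μ₀ η S (T + 1)).map (fun w i => w (Fin.castSucc i))
      = sgdTrajectory f nrm b μ₀ η S T := by
  have hm : Measurable fun (w : Fin (T + 2) → Weight d) (i : Fin (T + 1)) => w (Fin.castSucc i) := by
    fun_prop
  refine Measure.ext fun B hB => ?_
  rw [← lintegral_indicator_one hB, lintegral_map (measurable_one.indicator hB) hm,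
    lintegral_sgdTrajectory_succ f nrm hn hb μ₀ η S T
      (F := fun w => B.indicator 1 fun i => w (Fin.castSucc i))
      ((measurable_one.indicator hB).comp hm),
    ← lintegral_indicator_one hB]
  refine lintegral_congr fun w => ?_
  have := isProbabilityMeasure_laplace nrm hn hb (gradient (empiricalRisk f S) (w (Fin.last T)))
  simp

theorem map_sgdTrajectory_apply (f : Weight d → Example dX dY → ℝ)
    (nrm : Seminorm ℝ (Weight d)) (hn : ∀ v, nrm v = 0 → v = 0) {b : ℝ} (hb : 0 < b)
    (μ₀ : Measure (Weight d)) (η : ℕ → ℝ) (S : Fin N → Z) (T : ℕ) (t : Fin (T + 1)) :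
    (sgdTrajectory f nrm b μ₀ η S T).map (fun w => w t)
      = (sgdTrajectory f nrm b μ₀ η S t).map (fun w => w (Fin.last t)) := by
  induction T with
  | zero =>
    obtain rfl : t = 0 := Fin.fin_one_eq_zero t
    rfl
  | succ T ih =>
    refine Fin.lastCases rfl (fun t => ?_) t
    rw [show (sgdTrajectory f nrm b μ₀ η S (t.castSucc : Fin (T + 2))).map
        (fun w => w (Fin.last (t.castSucc : Fin (T + 2)))) = _ from (ih t).symm,
      ← map_init_sgdTrajectory f nrm hn hb μ₀ η S T, Measure.map_map (by fun_prop) (by fun_prop)]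
    rfl

/-- The privacy loss of a trajectory: the logarithm of the density of its law under `S` with
respect to its law under `S'`. -/
def trajectoryLoss (f : Weight d → Example dX dY → ℝ) (nrm : Seminorm ℝ (Weight d)) (b : ℝ)
    (η : ℕ → ℝ) (S S' : Fin N → Z) : (T : ℕ) → (Fin (T + 1) → Weight d) → ℝ
  | 0, _ => 0
  | T + 1, w => trajectoryLoss f nrm b η S S' T (fun i => w (Fin.castSucc i)) +
      -- For a nonzero rate the two last weights determine the gradient draw; for rate zero the step
      -- is deterministic and reveals nothing.
      if η T = 0 then 0 else
        laplaceLoss nrm b (gradient (empiricalRisk f S) (w (Fin.last T).castSucc))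
          (gradient (empiricalRisk f S') (w (Fin.last T).castSucc))
          ((η T)⁻¹ • (w (Fin.last T).castSucc - w (Fin.last (T + 1))))

theorem measurable_trajectoryLoss (f : Weight d → Example dX dY → ℝ) (nrm : Seminorm ℝ (Weight d))
    (b : ℝ) (η : ℕ → ℝ) (S S' : Fin N → Z) (T : ℕ) :
    Measurable (trajectoryLoss f nrm b η S S' T) := by
  induction T with
  | zero => exact measurable_const
  | succ T ih =>
    refine Measurable.add (ih.comp (by fun_prop)) ?_
    split_ifs
    · exact measurable_const
    · have h1 : Measurable fun w : Fin (T + 2) → Weight d => w (Fin.last T).castSucc :=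
        measurable_pi_apply _
      have h2 : Measurable fun w : Fin (T + 2) → Weight d =>
          (η T)⁻¹ • (w (Fin.last T).castSucc - w (Fin.last (T + 1))) :=
        (h1.sub (measurable_pi_apply (Fin.last (T + 1)))).const_smul (η T)⁻¹
      exact measurable_laplaceLoss nrm b ((measurable_gradient (empiricalRisk f S)).comp h1)
        ((measurable_gradient (empiricalRisk f S')).comp h1) h2

theorem trajectoryLoss_snoc (f : Weight d → Example dX dY → ℝ) (nrm : Seminorm ℝ (Weight d))
    (b : ℝ) (η : ℕ → ℝ) (S S' : Fin N → Z) (T : ℕ) (w : Fin (T + 1) → Weight d) (g : Weight d) :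
    trajectoryLoss f nrm b η S S' (T + 1) (Fin.snoc w (w (Fin.last T) - η T • g))
      = trajectoryLoss f nrm b η S S' T w +
        if η T = 0 then 0 else
          laplaceLoss nrm b (gradient (empiricalRisk f S) (w (Fin.last T)))
            (gradient (empiricalRisk f S') (w (Fin.last T))) g := by
  rw [trajectoryLoss]
  simp only [Fin.snoc_castSucc, Fin.snoc_last, sub_sub_cancel]
  congr 1
  split_ifs with h
  · rfl
  · rw [inv_smul_smul₀ h]

theorem lintegral_sgdTrajectory_eq (f : Weight d → Example dX dY → ℝ)
    (nrm : Seminorm ℝ (Weight d)) (hn : ∀ v, nrm v = 0 → v = 0) {b : ℝ} (hb : 0 < b)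
    (μ₀ : Measure (Weight d)) (η : ℕ → ℝ) (S S' : Fin N → Z) (T : ℕ)
    (F : (Fin (T + 1) → Weight d) → ENNReal) (hF : Measurable F) :
    ∫⁻ w, F w ∂sgdTrajectory f nrm b μ₀ η S' T
      = ∫⁻ w, F w * ENNReal.ofReal (Real.exp (-trajectoryLoss f nrm b η S S' T w))
          ∂sgdTrajectory f nrm b μ₀ η S T := by
  induction T with
  | zero => simp [trajectoryLoss, sgdTrajectory]
  | succ T ih =>
    have hl := measurable_trajectoryLoss f nrm b η S S' (T + 1)
    have hmeas : Measurable fun w : Fin (T + 1) → Weight d =>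
        ∫⁻ g, F (Fin.snoc w (w (Fin.last T) - η T • g))
          ∂laplace nrm b (gradient (empiricalRisk f S') (w (Fin.last T))) := by
      have hs (w : Fin (T + 1) → Weight d) :
          Measurable (fun θ => (Fin.snoc w θ : Fin (T + 2) → Weight d)) :=
        (measurable_snoc T).comp (measurable_const.prodMk measurable_id)
      convert (Measure.measurable_lintegral hF).comp (measurable_step f nrm hn hb S' (η T) T)
        using 2 with w
      rw [Function.comp_apply, lintegral_map hF (hs w), sgdStep,
        lintegral_map (f := fun θ => F (Fin.snoc w θ)) (hF.comp (hs w)) (by fun_prop)]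
    rw [lintegral_sgdTrajectory_succ f nrm hn hb μ₀ η S' T hF, ih _ hmeas,
      lintegral_sgdTrajectory_succ f nrm hn hb μ₀ η S T (F := fun w => F w *
        ENNReal.ofReal (Real.exp (-trajectoryLoss f nrm b η S S' (T + 1) w)))
        (hF.mul (by fun_prop))]
    refine lintegral_congr fun w => ?_
    simp only [trajectoryLoss_snoc, neg_add, Real.exp_add,
      ENNReal.ofReal_mul (Real.exp_pos _).le]
    simp_rw [mul_left_comm (F _)]
    rw [lintegral_const_mul' _ _ ENNReal.ofReal_ne_top, mul_comm]
    congr 1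
    have := isProbabilityMeasure_laplace nrm hn hb (gradient (empiricalRisk f S) (w (Fin.last T)))
    have := isProbabilityMeasure_laplace nrm hn hb (gradient (empiricalRisk f S') (w (Fin.last T)))
    split_ifs with h
    -- With rate zero the integrand is constant in `g`, and both Laplacians have mass 1.
    · simp [h]
    · exact lintegral_laplace nrm _ _ _

/-- The steps are not independent, but the conditional exponential moment of each has a
deterministic bound for almost every past under `S`, and that bound factors out of the integral. -/
theorem lintegral_exp_trajectoryLoss_le (f : Weight d → Example dX dY → ℝ)
    (nrm : Seminorm ℝ (Weight d)) (hn : ∀ v, nrm v = 0 → v = 0) {b : ℝ} (hb : 0 < b)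
    (μ₀ : Measure (Weight d)) [IsProbabilityMeasure μ₀] (η : ℕ → ℝ) (S S' : Fin N → Z) {c : ℝ}
    (hc : 0 ≤ c) (T : ℕ) (ε : Fin T → ℝ)
    (hε : ∀ t : Fin T, ∀ᵐ w ∂sgdTrajectory f nrm b μ₀ η S t,
      nrm (gradient (empiricalRisk f S) (w (Fin.last t))
        - gradient (empiricalRisk f S') (w (Fin.last t))) / b ≤ ε t) :
    ∫⁻ w, ENNReal.ofReal (Real.exp (c * trajectoryLoss f nrm b η S S' T w))
        ∂sgdTrajectory f nrm b μ₀ η S T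
      ≤ ENNReal.ofReal (Real.exp
          (∑ t, (c * (ε t ^ 2 * Real.exp (ε t)) + c ^ 2 * ε t ^ 2 / 2))) := by
  induction T with
  | zero =>
    have := isProbabilityMeasure_sgdTrajectory f nrm hn hb μ₀ η S 0
    simp [trajectoryLoss]
  | succ T ih =>
    have hl := measurable_trajectoryLoss f nrm b η S S' (T + 1)
    rw [lintegral_sgdTrajectory_succ f nrm hn hb μ₀ η S T (by fun_prop), Fin.sum_univ_castSucc,
      Real.exp_add, ENNReal.ofReal_mul (Real.exp_pos _).le]
    refine le_trans ?_ (mul_le_mul_left (ih (fun t => ε t.castSucc) fun t => hε t.castSucc) _)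
    rw [← lintegral_mul_const' _ _ ENNReal.ofReal_ne_top]
    refine lintegral_mono_ae ?_
    filter_upwards [hε (Fin.last T)] with w hw
    simp only [trajectoryLoss_snoc, mul_add, Real.exp_add, ENNReal.ofReal_mul (Real.exp_pos _).le]
    rw [lintegral_const_mul' _ _ ENNReal.ofReal_ne_top,
      ← ENNReal.ofReal_mul (Real.exp_pos _).le, ← Real.exp_add]
    gcongr
    split_ifs with h
    · have := isProbabilityMeasure_laplace nrm hn hb
        (gradient (empiricalRisk f S) (w (Fin.last T)))
      simp only [mul_zero, Real.exp_zero, ENNReal.ofReal_one, lintegral_const, measure_univ,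
        mul_one, ENNReal.one_le_ofReal]
      exact Real.one_le_exp (by positivity)
    · exact lintegral_laplace_exp_mul_le nrm hn hb hw hc

end Trajectory

/-! ### Sensitivity of the empirical gradient -/

section Gradient

variable {d dX dY N : ℕ} {Z : Set (Example dX dY)}

theorem gradient_empiricalRisk {f : Weight d → Example dX dY → ℝ}
    (hf : ∀ z ∈ Z, Differentiable ℝ fun θ => f θ z) (S : Fin N → Z) (θ : Weight d) :
    gradient (empiricalRisk f S) θ
      = (1 / (N : ℝ)) • ∑ i, gradient (fun θ => f θ (S i)) θ := by
  have h : HasFDerivAt (empiricalRisk f S)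
      ((1 / (N : ℝ)) • ∑ i, fderiv ℝ (fun θ => f θ (S i)) θ) θ := by
    unfold empiricalRisk
    exact (HasFDerivAt.fun_sum fun i _ => (hf _ (S i).2 θ).hasFDerivAt).const_mul _
  unfold gradient
  rw [h.fderiv, map_smul, map_sum]

theorem seminorm_gradient_empiricalRisk_sub_le {f : Weight d → Example dX dY → ℝ}
    (hf : ∀ z ∈ Z, Differentiable ℝ fun θ => f θ z) (nrm : Seminorm ℝ (Weight d))
    {S S' : Fin N → Z} (hS : Neighbouring S S') {θ : Weight d} {L : ℝ}
    (hL : ∀ z ∈ Z, nrm (gradient (fun θ => f θ z) θ) ≤ L) :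
    nrm (gradient (empiricalRisk f S) θ - gradient (empiricalRisk f S') θ) ≤ 2 * L / N := by
  obtain ⟨i, hi⟩ := hS
  rw [gradient_empiricalRisk hf, gradient_empiricalRisk hf, ← smul_sub, ← Finset.sum_sub_distrib,
    Finset.sum_eq_single i (fun j _ hj => by rw [hi j hj, sub_self]) (by simp),
    map_smul_eq_mul, Real.norm_of_nonneg (by positivity), one_div, inv_mul_eq_div]
  gcongr
  refine (map_sub_le_add nrm _ _).trans ?_
  linarith [hL _ (S i).2, hL _ (S' i).2]

theorem ae_gradient_le_gradientBound (f : Weight d → Example dX dY → ℝ)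
    (nrm : Seminorm ℝ (Weight d)) (b : ℝ) (μ₀ : Measure (Weight d)) (η : ℕ → ℝ) (S : Fin N → Z)
    {T : ℕ} (t : Fin T) (htop : gradientBound Z f nrm b μ₀ η N T t ≠ ⊤) :
    ∀ᵐ w ∂sgdTrajectory f nrm b μ₀ η S T, ∀ z ∈ Z,
      nrm (gradient (fun θ => f θ z) (w t.castSucc))
        ≤ (gradientBound Z f nrm b μ₀ η N T t).toReal := by
  filter_upwards [ENNReal.ae_le_essSup (μ := sgdTrajectory f nrm b μ₀ η S T)
    (fun w : Fin (T + 1) → Weight d =>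
      ⨆ z ∈ Z, ENNReal.ofReal (nrm (gradient (fun θ => f θ z) (w t.castSucc))))] with w hw z hz
  rw [← ENNReal.ofReal_le_iff_le_toReal htop]
  refine le_trans ?_ (hw.trans (le_iSup (fun S : Fin N → Z => essSup
    (fun w : Fin (T + 1) → Weight d =>
      ⨆ z ∈ Z, ENNReal.ofReal (nrm (gradient (fun θ => f θ z) (w t.castSucc))))
    (sgdTrajectory f nrm b μ₀ η S T)) S))
  exact le_iSup₂ (f := fun z _ => ENNReal.ofReal (nrm (gradient (fun θ => f θ z) (w t.castSucc))))
    z hz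

theorem ae_seminorm_gradient_sub_le {f : Weight d → Example dX dY → ℝ}
    (hf : ∀ z ∈ Z, Differentiable ℝ fun θ => f θ z)
    (nrm : Seminorm ℝ (Weight d)) (hn : ∀ v, nrm v = 0 → v = 0) {b : ℝ} (hb : 0 < b)
    (μ₀ : Measure (Weight d)) (η : ℕ → ℝ) {S S' : Fin N → Z} (hS : Neighbouring S S') {T : ℕ}
    (t : Fin T) (htop : gradientBound Z f nrm b μ₀ η N T t ≠ ⊤) :
    ∀ᵐ w ∂sgdTrajectory f nrm b μ₀ η S t,
      nrm (gradient (empiricalRisk f S) (w (Fin.last t))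
        - gradient (empiricalRisk f S') (w (Fin.last t)))
        ≤ 2 * (gradientBound Z f nrm b μ₀ η N T t).toReal / N := by
  -- The supremum over `Z` need not be measurable in the weight. This event involves only two
  -- gradients, so it is measurable and can be moved from the full trajectory to its prefix through
  -- their common marginal.
  set p : Weight d → Prop := fun θ =>
    nrm (gradient (empiricalRisk f S) θ - gradient (empiricalRisk f S') θ)
      ≤ 2 * (gradientBound Z f nrm b μ₀ η N T t).toReal / N
  have hp : MeasurableSet {θ | p θ} :=
    measurableSet_le ((seminorm_continuous nrm).measurable.comp
      ((measurable_gradient _).sub (measurable_gradient _))) measurable_const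
  have h : ∀ᵐ w ∂sgdTrajectory f nrm b μ₀ η S T, p (w t.castSucc) := by
    filter_upwards [ae_gradient_le_gradientBound f nrm b μ₀ η S t htop] with w hw
    exact seminorm_gradient_empiricalRisk_sub_le hf nrm hS hw
  rw [← ae_map_iff (f := fun w : Fin (T + 1) → Weight d => w t.castSucc)
      (measurable_pi_apply _).aemeasurable hp,
    map_sgdTrajectory_apply f nrm hn hb μ₀ η S T t.castSucc] at h
  exact (ae_map_iff (f := fun w : Fin ((t : ℕ) + 1) → Weight d => w (Fin.last t))
    (measurable_pi_apply _).aemeasurable hp).1 h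

end Gradient

/-! ### Fourth-power mean and Chernoff exponent -/

section Composition

/-- Cauchy–Schwarz in the form `(∑ L ^ 2) ^ 2 ≤ T * ∑ L ^ 4`. -/
theorem sum_sq_le_mul_fourthMean_sq {T : ℕ} (L : Fin T → ℝ) :
    ∑ t, L t ^ 2 ≤ T * fourthMean L ^ 2 := by
  have h0 : 0 ≤ (1 / (T : ℝ)) * ∑ t, L t ^ 4 := by positivity
  have h1 : fourthMean L ^ 2 = √((1 / (T : ℝ)) * ∑ t, L t ^ 4) := by
    rw [fourthMean, ← Real.rpow_natCast, ← Real.rpow_mul h0, Real.sqrt_eq_rpow]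
    norm_num
  rcases Nat.eq_zero_or_pos T with rfl | hT
  · simp
  have hT' : (0 : ℝ) < T := by exact_mod_cast hT
  rw [h1]
  refine le_of_sq_le_sq ?_ (by positivity)
  rw [mul_pow, Real.sq_sqrt h0]
  have := sq_sum_le_card_mul_sum_sq (s := Finset.univ) (f := fun t => L t ^ 2)
  simp only [← pow_mul, Finset.card_univ, Fintype.card_fin] at this
  refine this.trans (le_of_eq ?_)
  field_simp

theorem fourthMean_nonneg {T : ℕ} (L : Fin T → ℝ) : 0 ≤ fourthMean L :=
  Real.rpow_nonneg (by positivity) _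

/-- The choice of the exponent in the Chernoff bound; the slack `r` covers the case `V = 0`. -/
theorem exists_chernoff_exponent {V a l r : ℝ} (hV : 0 ≤ V) (ha : 0 ≤ a) (hl : 0 < l) (hr : 0 < r)
    (h : 2 * V * l ≤ a ^ 2) : ∃ c, 0 ≤ c ∧ c ^ 2 * V / 2 - c * (a + r) ≤ -l := by
  rcases hV.eq_or_lt with rfl | hV
  · refine ⟨l / r, by positivity, ?_⟩
    have : l / r * (a + r) = l / r * a + l := by field_simp
    have : 0 ≤ l / r * a := by positivity
    linarith
  -- This minimises `c ^ 2 * V / 2 - c * √(2 * V * l)`, with minimum `-l`.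
  · refine ⟨√(2 * l / V), by positivity, ?_⟩
    have h1 : √(2 * l / V) ^ 2 = 2 * l / V := Real.sq_sqrt (by positivity)
    have h2 : 2 * l ≤ √(2 * l / V) * a := by
      refine le_of_sq_le_sq ?_ (by positivity)
      rw [mul_pow (√_), h1]
      calc (2 * l) ^ 2 = 2 * l / V * (2 * V * l) := by field_simp
        _ ≤ _ := by gcongr
    have h3 : √(2 * l / V) ^ 2 * V / 2 = l := by rw [h1]; field_simp
    nlinarith [Real.sqrt_nonneg (2 * l / V)]

end Composition

/-! ### The privacy guarantee -/

/-- The privacy guarantee for the law of the whole trajectory. -/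
theorem sgdTrajectory_le_add_of_neighbouring {d dX dY N T : ℕ} {Z : Set (Example dX dY)}
    {f : Weight d → Example dX dY → ℝ} (hf : ∀ z ∈ Z, Differentiable ℝ fun θ => f θ z)
    (nrm : Seminorm ℝ (Weight d)) (hn : ∀ v, nrm v = 0 → v = 0) {b : ℝ} (hb : 0 < b)
    (μ₀ : Measure (Weight d)) [IsProbabilityMeasure μ₀] (η : ℕ → ℝ) (hN : 0 < N) {M : ℝ}
    (hM0 : 0 ≤ M) {L : Fin T → ℝ} (hL : ∀ t, L t = (gradientBound Z f nrm b μ₀ η N T t).toReal)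
    (hM : ∀ t, gradientBound Z f nrm b μ₀ η N T t ≤ ENNReal.ofReal M) {δ' : ℝ} (hδ' : 0 < δ')
    {S S' : Fin N → Z} (hS : Neighbouring S S') {B : Set (Fin (T + 1) → Weight d)}
    (hB : MeasurableSet B) :
    sgdTrajectory f nrm b μ₀ η S T B ≤
      ENNReal.ofReal (Real.exp (2 * fourthMean L / (N * b) * √(2 * T * Real.log (N / δ'))
        + (T * ((2 * M / b) ^ 2 * Real.exp (2 * M / b)) + 1) / (N : ℝ) ^ 2))
        * sgdTrajectory f nrm b μ₀ η S' T B + ENNReal.ofReal (δ' / N) := by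
  have hN' : (0 : ℝ) < N := by exact_mod_cast hN
  have hN1 : (1 : ℝ) ≤ N := by exact_mod_cast hN
  have := isProbabilityMeasure_sgdTrajectory f nrm hn hb μ₀ η S T
  rcases le_or_gt (N : ℝ) δ' with h | h
  -- Here `δ' / N ≥ 1`, so the additive term alone dominates any probability.
  · refine le_add_left (prob_le_one.trans ?_)
    rw [ENNReal.one_le_ofReal, le_div_iff₀ hN']
    linarith
  have hl : 0 < Real.log (N / δ') := Real.log_pos ((one_lt_div hδ').2 h)
  have hL0 (t) : 0 ≤ L t := hL t ▸ ENNReal.toReal_nonneg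
  have hLM (t) : L t ≤ M := by
    rw [hL t]
    exact ENNReal.toReal_le_of_le_ofReal hM0 (hM t)
  set ε : Fin T → ℝ := fun t => 2 * L t / (N * b) with hεdef
  have hε0 (t) : 0 ≤ ε t := by have := hL0 t; positivity
  have hεM (t) : ε t ≤ 2 * M / b / N := by
    calc ε t ≤ 2 * M / (N * b) := by
          simp only [hεdef]
          gcongr
          exact hLM t
      _ = _ := by rw [div_div, mul_comm b]
  have hεM' (t) : ε t ≤ 2 * M / b := (hεM t).trans (div_le_self (by positivity) hN1)
  set a := 2 * fourthMean L / (N * b) * √(2 * T * Real.log (N / δ')) with ha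
  have ha0 : 0 ≤ a := by have := fourthMean_nonneg L; positivity
  have hV : 2 * (∑ t, ε t ^ 2) * Real.log (N / δ') ≤ a ^ 2 := by
    have h1 : ∑ t, ε t ^ 2 = (2 / (N * b)) ^ 2 * ∑ t, L t ^ 2 := by
      rw [Finset.mul_sum]
      refine Finset.sum_congr rfl fun t _ => ?_
      simp only [hεdef]
      ring
    rw [h1, ha, mul_pow, Real.sq_sqrt (by positivity)]
    calc _ ≤ 2 * ((2 / (N * b)) ^ 2 * (T * fourthMean L ^ 2)) * Real.log (N / δ') := by
          gcongr
          exact sum_sq_le_mul_fourthMean_sq L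
      _ = _ := by ring
  -- The slack `r` is the source of the `+ 1` in the constant.
  obtain ⟨c, hc, hc'⟩ := exists_chernoff_exponent (r := 1 / (N : ℝ) ^ 2)
    (Finset.sum_nonneg fun t _ => sq_nonneg (ε t)) ha0 hl (by positivity) hV
  refine measure_le_of_lintegral_exp_mul_le (measurable_trajectoryLoss f nrm b η S S' T)
    (lintegral_sgdTrajectory_eq f nrm hn hb μ₀ η S S' T) hc
    (lintegral_exp_trajectoryLoss_le f nrm hn hb μ₀ η S S' hc T ε fun t => ?_) ?_ hB
  · filter_upwards [ae_seminorm_gradient_sub_le hf nrm hn hb μ₀ η hS t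
      ((hM t).trans_lt ENNReal.ofReal_lt_top).ne] with w hw
    rw [← hL t] at hw
    simp only [hεdef, ← div_div]
    gcongr
  -- The square supplies the factor `1 / N ^ 2`; in the exponential the bound uniform in `N` is
  -- enough.
  · have hmean : ∑ t, ε t ^ 2 * Real.exp (ε t)
        ≤ T * ((2 * M / b) ^ 2 * Real.exp (2 * M / b)) / (N : ℝ) ^ 2 := by
      calc ∑ t, ε t ^ 2 * Real.exp (ε t)
          ≤ ∑ _t : Fin T, (2 * M / b / N) ^ 2 * Real.exp (2 * M / b) := by
            refine Finset.sum_le_sum fun t _ => ?_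
            have := hε0 t
            gcongr
            · exact hεM t
            · exact hεM' t
        _ = _ := by
            rw [Finset.sum_const, Finset.card_univ, Fintype.card_fin, nsmul_eq_mul]
            ring
    have hexp : δ' / N = Real.exp (-Real.log (N / δ')) := by
      rw [Real.exp_neg, Real.exp_log (by positivity), inv_div]
    rw [hexp]
    apply Real.exp_le_exp.2
    rw [Finset.sum_add_distrib, ← Finset.mul_sum, ← Finset.sum_div, ← Finset.mul_sum, add_div]
    have := mul_le_mul_of_nonneg_left hmean hc
    linarith

end PrivateERM

end

theorem mainTheorem8 (T : ℕ) (b : ℝ) (hb : 0 < b) (M : ℝ) :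
    ∃ C : ℝ, ∀ (d dX dY : ℕ) (P : Type*)
      (Z : Set (PrivateERM.Example dX dY))
      (h : PrivateERM.Weight d → EuclideanSpace ℝ (Fin dX) → P)
      (l : P → EuclideanSpace ℝ (Fin dY) → ℝ)
      (_hdiff : ∀ z ∈ Z, Differentiable ℝ (fun θ => PrivateERM.exampleLoss h l θ z))
      (nrm : Seminorm ℝ (PrivateERM.Weight d)) (_hnrm : ∀ v, nrm v = 0 → v = 0)
      (μ₀ : MeasureTheory.Measure (PrivateERM.Weight d))
      (_hμ₀ : MeasureTheory.IsProbabilityMeasure μ₀)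
      (η : ℕ → ℝ) (N : ℕ) (_hN : 0 < N) (L : Fin T → ℝ)
      (_hL : ∀ t, L t = (PrivateERM.gradientBound Z (PrivateERM.exampleLoss h l) nrm b μ₀ η
        N T t).toReal)
      (_hM : ∀ t, PrivateERM.gradientBound Z (PrivateERM.exampleLoss h l) nrm b μ₀ η
        N T t ≤ ENNReal.ofReal M)
      (δ' : ℝ) (_hδ' : 0 < δ') (εERM : ℝ)
      (_hεERM : εERM = 2 * PrivateERM.fourthMean L / (N * b)),
      PrivateERM.IsDifferentiallyPrivate
          (fun S : Fin N → Z =>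
            PrivateERM.sgdOutput (PrivateERM.exampleLoss h l) nrm b μ₀ η T S)
          (εERM * √(2 * T * Real.log (N / δ')) + C / (N : ℝ) ^ 2) (δ' / N) ∧
      PrivateERM.IsDifferentiallyPrivate
          (fun S : Fin N → Z =>
            PrivateERM.sgdTrajectory (PrivateERM.exampleLoss h l) nrm b μ₀ η S T)
          (εERM * √(2 * T * Real.log (N / δ')) + C / (N : ℝ) ^ 2) (δ' / N) := by
  -- `M` may be negative; `ENNReal.ofReal M` is then zero, so `max M 0` is an equally valid bound.
  refine ⟨T * ((2 * max M 0 / b) ^ 2 * Real.exp (2 * max M 0 / b)) + 1, ?_⟩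
  intro d dX dY P Z h l hdiff nrm hnrm μ₀ hμ₀ η N hN L hL hM δ' hδ' εERM hεERM
  have key := fun (S S' : Fin N → Z) (hS : PrivateERM.Neighbouring S S')
      (B : Set (Fin (T + 1) → PrivateERM.Weight d)) (hB : MeasurableSet B) =>
    PrivateERM.sgdTrajectory_le_add_of_neighbouring hdiff nrm hnrm hb μ₀ η hN
      (le_max_right M 0) hL
      (fun t => (hM t).trans (ENNReal.ofReal_le_ofReal (le_max_left M 0))) hδ' hS hB
  subst hεERM
  refine ⟨fun S S' hS B hB => ?_, key⟩
  have hm : Measurable fun w : Fin (T + 1) → PrivateERM.Weight d => w (Fin.last T) :=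
    measurable_pi_apply _
  -- Post-processing: an event for the output is the preimage of that event among trajectories.
  simp only [PrivateERM.sgdOutput, MeasureTheory.Measure.map_apply hm hB]
  exact key S S' hS _ (hm hB)
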